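/- Let $X, Y, Y_1, Y_2$ be (real) Hilbert spaces, let $X_1\subset X$ be a convex subset, and let $L : Y_1\oplus Y_2\to Y$ be a continuous linear surjection. For $i=1,2$ let $F_i : X_1\to 2^{Y_i}$ be a set-valued mapping with convex closed bounded images which is uniformly continuous with modulus $\omega_i:[0,+\infty)\to[0,+\infty)$, that is, $\lim_{t\to+0}\omega_i(t)=0$ and $h(F_i(x),F_i(x'))\le\omega_i(\|x-x'\|)$ for all $x,x'\in X_1$, where $h$ is the Hausdorff distance. Write $(F_1(x),F_2(x))=\{(y_1,y_2)\in Y_1\oplus Y_2 \mid y_1\in F_1(x),\ y_2\in F_2(x)\}$ and suppose that $d=\sup_{x\in X_1}\operatorname{diam}(F_1(x),F_2(x))<+\infty$. Let $f:X_1\to Y$ be Lipschitz continuous with $f(x)\in L(F_1(x),F_2(x))$ for all $x\in X_1$. Then for every $\varepsilon>0$ there exist Lipschitz continuous functions $f_i:X_1\to Y_i$, $i=1,2$, such that $f_i(x)\in F_i(x)+B^{Y_i}_\varepsilon(0)$ and $f(x)=L(f_1(x),f_2(x))$ for all $x\in X_1$, where $B^{Y_i}_\varepsilon(0)=\{y\in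 Y_i\mid \|y\|\le\varepsilon\}$. -/

import Mathlib

open scoped NNReal ENNReal Topology Pointwise

/-- The pair `(A, B)` of two sets, as a subset of the Hilbert direct sum `Y₁ ⊕ Y₂`
(the product with the norm `‖(u, v)‖² = ‖u‖² + ‖v‖²`). -/
def pairSet {Y₁ Y₂ : Type*} (A : Set Y₁) (B : Set Y₂) : Set (WithLp 2 (Y₁ × Y₂)) :=
  {z | z.fst ∈ A ∧ z.snd ∈ B}

/-- The set-valued mapping `F` is uniformly continuous with modulus `ω : [0, ∞) → [0, ∞)`:
`ω t → 0` as `t → 0+`, and the Hausdorff distance of `F x` and `F x'` is at most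
`ω (dist x x')`. The extended Hausdorff distance is used, so that the bound has its
literal meaning for arbitrary sets. -/
def UniformlyContinuousWithModulus {X Y : Type*} [PseudoMetricSpace X] [PseudoMetricSpace Y]
    (F : X → Set Y) (ω : ℝ≥0 → ℝ≥0) : Prop :=
  Filter.Tendsto ω (𝓝[>] 0) (𝓝 0) ∧
    ∀ x x' : X, Metric.hausdorffEDist (F x) (F x') ≤ (ω (nndist x x') : ℝ≥0∞)

/-!
Fix a continuous linear right inverse `R` of `L`. A lift of `f` through `L` has the form
`x ↦ R (f x) + v x` with `v` valued in `V = ker L`, so it suffices to find a Lipschitz approximate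
selection `v` of the translates `F x - R (f x)`, each of which meets `V`. The traces on `V` of small
thickenings of these translates are convex, of bounded diameter, and again uniformly continuous:
contracting a point slightly towards a point of `V` in the set itself undoes an enlargement of the
radius.

A uniformly continuous family of convex sets of bounded diameter in a Hilbert space has a uniformly
continuous selection: its arbitrary selections are Lipschitz at large scales, so they stay at
bounded distance from a Lipschitz map `b`, and one projects `b x` onto the closure of the set at
`x`. Finally, by Kirszbraun's theorem applied to a maximal separated subset of `X₁`, uniformly
continuous maps on a convex set are uniform limits of Lipschitz maps.
-/

open Metric
open scoped RealInnerProductSpace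

/-! ### Kirszbraun's theorem -/

section Kirszbraun

variable {X Y : Type*} [NormedAddCommGroup X] [InnerProductSpace ℝ X]
  [NormedAddCommGroup Y] [InnerProductSpace ℝ Y]

theorem norm_sum_smul_sq_eq {ι : Type*} [Fintype ι] {w : ι → ℝ} (hw : ∑ i, w i = 1) (g : ι → Y) :
    ‖∑ i, w i • g i‖ ^ 2 =
      ∑ i, w i * ‖g i‖ ^ 2 - (∑ i, ∑ j, w i * w j * ‖g i - g j‖ ^ 2) / 2 := by
  have h_inner : ‖∑ i, w i • g i‖ ^ 2 = ∑ i, ∑ j, w i * w j * ⟪g i, g j⟫ := by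
    rw [← real_inner_self_eq_norm_sq, sum_inner]
    simp only [inner_sum, real_inner_smul_left, real_inner_smul_right]
    exact Finset.sum_congr rfl fun i _ => Finset.sum_congr rfl fun j _ => by ring
  have h_expand : ∀ i, ∑ j, w i * w j * ‖g i - g j‖ ^ 2 =
      w i * ‖g i‖ ^ 2 - 2 * ∑ j, w i * w j * ⟪g i, g j⟫ + w i * ∑ j, w j * ‖g j‖ ^ 2 := by
    intro i
    calc ∑ j, w i * w j * ‖g i - g j‖ ^ 2
        = ∑ j, (w j * (w i * ‖g i‖ ^ 2) - 2 * (w i * w j * ⟪g i, g j⟫)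
            + w i * (w j * ‖g j‖ ^ 2)) :=
          Finset.sum_congr rfl fun j _ => by rw [norm_sub_sq_real]; ring
      _ = _ := by
          rw [Finset.sum_add_distrib, Finset.sum_sub_distrib, ← Finset.sum_mul, ← Finset.mul_sum,
            ← Finset.mul_sum, hw, one_mul]
  simp only [h_expand, Finset.sum_add_distrib, Finset.sum_sub_distrib, ← Finset.mul_sum,
    ← Finset.sum_mul, hw, h_inner]
  ring

theorem sum_mul_norm_sq_sub_le_norm_sum_smul_sq {ι : Type*} [Fintype ι] {w : ι → ℝ}
    (hw : w ∈ stdSimplex ℝ ι) {u : ι → X} {g : ι → Y} (h : ∀ i j, ‖g i - g j‖ ≤ ‖u i - u j‖) :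
    ∑ i, w i * (‖g i‖ ^ 2 - ‖u i‖ ^ 2) ≤ ‖∑ i, w i • g i‖ ^ 2 := by
  have h_dist : ∑ i, ∑ j, w i * w j * ‖g i - g j‖ ^ 2 ≤ ∑ i, ∑ j, w i * w j * ‖u i - u j‖ ^ 2 :=
    Finset.sum_le_sum fun i _ => Finset.sum_le_sum fun j _ =>
      mul_le_mul_of_nonneg_left (pow_le_pow_left₀ (norm_nonneg _) (h i j) 2)
        (mul_nonneg (hw.1 i) (hw.1 j))
  have hu : 0 ≤ ‖∑ i, w i • u i‖ ^ 2 := sq_nonneg _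
  rw [norm_sum_smul_sq_eq hw.2] at hu
  rw [norm_sum_smul_sq_eq hw.2]
  simp only [mul_sub, Finset.sum_sub_distrib]
  linarith

theorem nonpos_of_forall_mul_le_sq_mul {s c : ℝ} (h : ∀ t ∈ Set.Ioc (0 : ℝ) 1, t * s ≤ t ^ 2 * c) :
    s ≤ 0 := by
  have h_lim : Filter.Tendsto (fun t : ℝ => t * c) (𝓝[>] 0) (𝓝 0) := by
    have h_cont : Continuous fun t : ℝ => t * c := by fun_prop
    simpa using (h_cont.tendsto 0).mono_left nhdsWithin_le_nhds
  refine ge_of_tendsto h_lim ?_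
  filter_upwards [Ioc_mem_nhdsGT one_pos] with t ht
  exact le_of_mul_le_mul_left ((h t ht).trans_eq (by ring)) ht.1

theorem sub_two_inner_le_of_isMaxOn {E : Type*} [AddCommGroup E] [Module ℝ E] {S : Set E}
    (hS : Convex ℝ S) (ℓ : E →ₗ[ℝ] ℝ) (T : E →ₗ[ℝ] Y) {w v : E} (hw : w ∈ S) (hv : v ∈ S)
    (hmax : IsMaxOn (fun z => ℓ z - ‖T z‖ ^ 2) S w) :
    ℓ v - 2 * ⟪T w, T v⟫ ≤ ℓ w - 2 * ‖T w‖ ^ 2 := by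
  have h_slope : ℓ (v - w) - 2 * ⟪T w, T (v - w)⟫ ≤ 0 := by
    refine nonpos_of_forall_mul_le_sq_mul (c := ‖T (v - w)‖ ^ 2) fun t ht => ?_
    have h_le : ℓ (w + t • (v - w)) - ‖T (w + t • (v - w))‖ ^ 2 ≤ ℓ w - ‖T w‖ ^ 2 :=
      hmax (hS.add_smul_sub_mem hw hv ⟨ht.1.le, ht.2⟩)
    rw [map_add, map_smul, map_add, map_smul, smul_eq_mul, norm_add_sq_real, real_inner_smul_right,
      norm_smul, mul_pow, Real.norm_eq_abs, sq_abs] at h_le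
    linarith
  rw [map_sub, map_sub, inner_sub_right, real_inner_self_eq_norm_sq] at h_slope
  linarith

-- The point is `∑ i, w i • g i`, where `w` maximises the dual function
-- `w ↦ ∑ i, w i * (‖g i‖ ^ 2 - ‖u i‖ ^ 2) - ‖∑ i, w i • g i‖ ^ 2` over the simplex.
theorem exists_forall_norm_sub_le_of_finite {ι : Type*} [Finite ι] {u : ι → X} {g : ι → Y}
    (h : ∀ i j, ‖g i - g j‖ ≤ ‖u i - u j‖) : ∃ c : Y, ∀ i, ‖c - g i‖ ≤ ‖u i‖ := by
  classical
  cases nonempty_fintype ι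
  rcases isEmpty_or_nonempty ι with hι | ⟨⟨i₀⟩⟩
  · exact ⟨0, fun i => hι.elim i⟩
  let ℓ : (ι → ℝ) →ₗ[ℝ] ℝ := Fintype.linearCombination ℝ fun i => ‖g i‖ ^ 2 - ‖u i‖ ^ 2
  let T : (ι → ℝ) →ₗ[ℝ] Y := Fintype.linearCombination ℝ g
  obtain ⟨w, hw, hmax⟩ := (isCompact_stdSimplex ℝ ι).exists_isMaxOn
    ⟨_, single_mem_stdSimplex ℝ i₀⟩ (f := fun w => ℓ w - ‖T w‖ ^ 2)
    (((ℓ.continuous_of_finiteDimensional).sub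
      (T.continuous_of_finiteDimensional.norm.pow 2)).continuousOn)
  have h_value : ℓ w ≤ ‖T w‖ ^ 2 := sum_mul_norm_sq_sub_le_norm_sum_smul_sq hw h
  refine ⟨T w, fun i => ?_⟩
  have h_first_order :=
    sub_two_inner_le_of_isMaxOn (convex_stdSimplex ℝ ι) ℓ T hw (single_mem_stdSimplex ℝ i) hmax
  simp only [ℓ, T, Fintype.linearCombination_apply_single, one_smul] at h_first_order h_value ⊢
  refine (pow_le_pow_iff_left₀ (norm_nonneg _) (norm_nonneg _) two_ne_zero).1 ?_
  rw [norm_sub_sq_real]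
  linarith

-- Closed balls of a Hilbert space are weakly compact, so finitely many constraints suffice.
theorem exists_forall_norm_sub_le [CompleteSpace Y] {ι : Type*} {u : ι → X} {g : ι → Y}
    (h : ∀ i j, ‖g i - g j‖ ≤ ‖u i - u j‖) : ∃ c : Y, ∀ i, ‖c - g i‖ ≤ ‖u i‖ := by
  classical
  rcases isEmpty_or_nonempty ι with hι | ⟨⟨i₀⟩⟩
  · exact ⟨0, fun i => hι.elim i⟩
  let T := InnerProductSpace.toDual ℝ Y
  let B : ι → Set (WeakDual ℝ Y) := fun i =>
    WeakDual.toStrongDual ⁻¹' closedBall (T (g i)) ‖u i‖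
  have hB : ∀ i, IsCompact (B i) := fun i => WeakDual.isCompact_closedBall _ _
  have h_mem_iff : ∀ c i, StrongDual.toWeakDual (T c) ∈ B i ↔ ‖c - g i‖ ≤ ‖u i‖ := fun c i => by
    rw [← dist_eq_norm, ← T.isometry.dist_eq]
    exact Iff.rfl
  obtain ⟨φ, -, hφ⟩ := (hB i₀).inter_iInter_nonempty B (fun i => (hB i).isClosed) fun s => by
    obtain ⟨c, hc⟩ := exists_forall_norm_sub_le_of_finite
      (u := fun i : (insert i₀ s : Finset ι) => u i) (g := fun i => g i) fun i j => h i j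
    have h_mem : ∀ i ∈ insert i₀ s, StrongDual.toWeakDual (T c) ∈ B i := fun i hi =>
      (h_mem_iff c i).2 (hc ⟨i, hi⟩)
    exact ⟨_, h_mem i₀ (Finset.mem_insert_self _ _),
      Set.mem_iInter₂.2 fun i hi => h_mem i (Finset.mem_insert_of_mem hi)⟩
  refine ⟨T.symm (WeakDual.toStrongDual φ), fun i => (h_mem_iff _ i).1 ?_⟩
  rw [T.apply_symm_apply]
  exact Set.mem_iInter.1 hφ i

theorem exists_forall_dist_le_mul_dist [CompleteSpace Y] {K : ℝ≥0} {ι : Type*} {u : ι → X}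
    {g : ι → Y} (h : ∀ i j, dist (g i) (g j) ≤ K * dist (u i) (u j)) (x : X) :
    ∃ y : Y, ∀ i, dist y (g i) ≤ K * dist x (u i) := by
  have h_norm : ∀ x x' : X, ‖(K : ℝ) • (x - x')‖ = K * dist x x' := fun x x' => by
    rw [norm_smul, Real.norm_of_nonneg K.coe_nonneg, dist_eq_norm]
  obtain ⟨y, hy⟩ := exists_forall_norm_sub_le (u := fun i => (K : ℝ) • (x - u i)) (g := g)
    fun i j => by
      rw [← smul_sub, sub_sub_sub_cancel_left, h_norm, ← dist_eq_norm, dist_comm (u j)]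
      exact h i j
  exact ⟨y, fun i => by rw [dist_eq_norm, ← h_norm]; exact hy i⟩

-- The map to be extended is `u i ↦ g i`, which the hypothesis makes well defined.
theorem exists_lipschitzWith_forall_apply_eq [CompleteSpace Y] {K : ℝ≥0} {ι : Type*} {u : ι → X}
    {g : ι → Y} (h : ∀ i j, dist (g i) (g j) ≤ K * dist (u i) (u j)) :
    ∃ G : X → Y, LipschitzWith K G ∧ ∀ i, G (u i) = g i := by
  let graphs : Set (Set (X × Y)) := {A | ∀ p ∈ A, ∀ q ∈ A, dist p.2 q.2 ≤ K * dist p.1 q.1}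
  have h_range : Set.range (fun i => (u i, g i)) ∈ graphs := by
    rintro _ ⟨i, rfl⟩ _ ⟨j, rfl⟩
    exact h i j
  obtain ⟨M, h_sub, hM⟩ := zorn_subset_nonempty graphs (fun c hc hchain _ => by
    refine ⟨⋃₀ c, ?_, fun s => Set.subset_sUnion_of_mem⟩
    rintro p ⟨A, hA, hpA⟩ q ⟨B, hB, hqB⟩
    obtain ⟨S, hS, hAS, hBS⟩ := hchain.directedOn A hA B hB
    exact hc hS p (hAS hpA) q (hBS hqB)) _ h_range
  have h_dom : ∀ x, ∃ y, (x, y) ∈ M := by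
    intro x
    obtain ⟨y, hy⟩ := exists_forall_dist_le_mul_dist (u := fun p : M => p.1.1)
      (g := fun p : M => p.1.2) (fun p q => hM.prop p p.2 q q.2) x
    refine ⟨y, hM.le_of_ge ?_ (Set.subset_insert (x, y) M) (Set.mem_insert _ _)⟩
    rintro p (rfl | hp) q (rfl | hq)
    · simp
    · exact hy ⟨q, hq⟩
    · simpa only [dist_comm] using hy ⟨p, hp⟩
    · exact hM.prop p hp q hq
  choose G hG using h_dom
  refine ⟨G, LipschitzWith.of_dist_le_mul fun x x' => hM.prop _ (hG x) _ (hG x'), fun i => ?_⟩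
  have h_dist := hM.prop _ (hG (u i)) _ (h_sub ⟨i, rfl⟩)
  exact dist_le_zero.1 (by simpa using h_dist)

end Kirszbraun

/-! ### Lipschitz approximation of maps controlled at a fixed scale -/

section CoarseLipschitz

theorem dist_le_succ_mul_of_forall_dist_le {X M : Type*} [NormedAddCommGroup X] [NormedSpace ℝ X]
    [PseudoMetricSpace M] {X₁ : Set X} (hX₁ : Convex ℝ X₁) {g : X₁ → M} {δ η : ℝ}
    (hg : ∀ x x', dist x x' ≤ δ → dist (g x) (g x') ≤ η) (n : ℕ) (x x' : X₁)
    (hx : dist x x' ≤ (n + 1) * δ) : dist (g x) (g x') ≤ (n + 1) * η := by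
  induction n generalizing x with
  | zero => simpa using hg x x' (by simpa using hx)
  | succ n ih =>
    push_cast at hx ⊢
    set t : ℝ := 1 / (n + 2) with ht
    have ht_mem : t ∈ Set.Icc (0 : ℝ) 1 := ⟨by positivity, by rw [ht, div_le_one] <;> linarith⟩
    let y : X₁ := ⟨AffineMap.lineMap x.1 x'.1 t, hX₁.lineMap_mem x.2 x'.2 ht_mem⟩
    have h_step : dist x x' * t ≤ δ := by
      rw [ht, mul_one_div, div_le_iff₀ (by positivity)]
      linarith
    have hxy : dist x y ≤ δ := by
      rw [Subtype.dist_eq, dist_left_lineMap, Real.norm_of_nonneg ht_mem.1, mul_comm]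
      exact h_step
    have hyx' : dist y x' ≤ (n + 1) * δ := by
      have ht_compl : 1 - t = (n + 1) * t := by rw [ht]; field_simp; ring
      rw [Subtype.dist_eq, dist_lineMap_right, Real.norm_of_nonneg (by linarith [ht_mem.2]),
        ht_compl, mul_assoc, mul_comm t]
      exact mul_le_mul_of_nonneg_left h_step (by positivity)
    calc dist (g x) (g x') ≤ dist (g x) (g y) + dist (g y) (g x') := dist_triangle _ _ _
      _ ≤ η + (n + 1) * η := add_le_add (hg x y hxy) (ih y hyx')
      _ = (n + 1 + 1) * η := by ring

theorem dist_le_mul_dist_div_add_one_of_forall_dist_le {X M : Type*} [NormedAddCommGroup X]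
    [NormedSpace ℝ X] [PseudoMetricSpace M] {X₁ : Set X} (hX₁ : Convex ℝ X₁) {g : X₁ → M} {δ η : ℝ}
    (hδ : 0 < δ) (hg : ∀ x x', dist x x' ≤ δ → dist (g x) (g x') ≤ η) (x x' : X₁) :
    dist (g x) (g x') ≤ (dist x x' / δ + 1) * η := by
  have hη : 0 ≤ η := dist_nonneg.trans (hg x x (by simpa using hδ.le))
  set n := ⌊dist x x' / δ⌋₊
  have h_le : dist x x' ≤ (n + 1) * δ := (div_le_iff₀ hδ).1 (Nat.lt_floor_add_one _).le
  have hn : (n : ℝ) ≤ dist x x' / δ := Nat.floor_le (by positivity)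
  exact (dist_le_succ_mul_of_forall_dist_le hX₁ hg n x x' h_le).trans
    (mul_le_mul_of_nonneg_right (by linarith) hη)

theorem exists_isSeparated_isCover_univ (X : Type*) [PseudoEMetricSpace X] (ε : ℝ≥0) :
    ∃ N : Set X, IsSeparated ε N ∧ IsCover ε Set.univ N := by
  obtain ⟨N, hN⟩ := zorn_subset {N : Set X | N ⊆ Set.univ ∧ IsSeparated ε N} fun c hc hchain =>
    ⟨⋃₀ c, ⟨Set.subset_univ _,
      (Set.pairwise_sUnion hchain.directedOn).2 fun N hN => (hc hN).2⟩,
      fun N => Set.subset_sUnion_of_mem⟩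
  exact ⟨N, hN.prop.2, IsCover.of_maximal_isSeparated hN⟩

theorem exists_lipschitzWith_forall_dist_le {X H : Type*} [NormedAddCommGroup X]
    [InnerProductSpace ℝ X] [NormedAddCommGroup H] [InnerProductSpace ℝ H] [CompleteSpace H]
    {X₁ : Set X} (hX₁ : Convex ℝ X₁) {g : X₁ → H} {δ η : ℝ} (hδ : 0 < δ) (hη : 0 ≤ η)
    (hg : ∀ x x', dist x x' ≤ δ → dist (g x) (g x') ≤ η) :
    ∃ G : X₁ → H, (∃ K : ℝ≥0, LipschitzWith K G) ∧ ∀ x, dist (G x) (g x) ≤ 3 * η := by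
  lift δ to ℝ≥0 using hδ.le
  lift η to ℝ≥0 using hη
  obtain ⟨N, hN_sep, hN_cover⟩ := exists_isSeparated_isCover_univ X₁ δ
  let K : ℝ≥0 := 2 * η / δ
  have hK : (K : ℝ) = 2 * η / δ := by simp [K]
  have h_lip : ∀ s t : N, dist (g s) (g t) ≤ K * dist (s : X) (t : X) := by
    intro s t
    rcases eq_or_ne s t with rfl | hst
    · simp
    have h_sep : (δ : ℝ) < dist (s : X₁) t := by
      have h_edist : (δ : ℝ≥0∞) < edist (s : X₁) t := hN_sep s.2 t.2 (Subtype.coe_ne_coe.2 hst)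
      rwa [edist_nndist, ENNReal.coe_lt_coe] at h_edist
    have h_one_le : 1 ≤ dist (s : X₁) t / δ := (one_le_div hδ).2 h_sep.le
    calc dist (g s) (g t) ≤ (dist (s : X₁) t / δ + 1) * η :=
          dist_le_mul_dist_div_add_one_of_forall_dist_le hX₁ hδ hg s t
      _ ≤ (dist (s : X₁) t / δ + dist (s : X₁) t / δ) * η := by gcongr
      _ = K * dist (s : X) t := by rw [hK, Subtype.dist_eq]; ring
  obtain ⟨G, hG, hG_eq⟩ := exists_lipschitzWith_forall_apply_eq (u := fun s : N => (s : X))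
    (g := fun s : N => g s) h_lip
  refine ⟨fun x => G x, ⟨K * 1, hG.comp (LipschitzWith.subtype_val X₁)⟩, fun x => ?_⟩
  obtain ⟨s, hs, hxs⟩ := hN_cover (Set.mem_univ x)
  have hxs : dist x s ≤ δ := edist_le_coe.1 hxs
  have hGs : G s = g s := hG_eq ⟨s, hs⟩
  calc dist (G x) (g x) ≤ dist (G x) (G s) + dist (g s) (g x) := hGs ▸ dist_triangle _ _ _
    _ ≤ K * δ + η := add_le_add ((hG.dist_le_mul _ _).trans (by gcongr; exact hxs))
        (hg s x (dist_comm x s ▸ hxs))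
    _ = 3 * η := by rw [hK, div_mul_cancel₀ _ hδ.ne']; ring

end CoarseLipschitz

/-! ### Uniformly continuous set-valued maps -/

/-- Uniform continuity of a set-valued map with respect to the Hausdorff distance, in the
`ε`-`δ` form convenient for constructing new maps from old ones. Only one inclusion is required:
exchanging `x` and `x'` gives the other one. -/
def HausdorffUniformContinuous {X Y : Type*} [PseudoMetricSpace X] [PseudoMetricSpace Y]
    (F : X → Set Y) : Prop :=
  ∀ η > 0, ∃ δ > 0, ∀ x x', dist x x' ≤ δ → F x ⊆ thickening η (F x')

theorem UniformlyContinuousWithModulus.hausdorffUniformContinuous {X Y : Type*} [MetricSpace X]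
    [PseudoMetricSpace Y] {F : X → Set Y} {ω : ℝ≥0 → ℝ≥0}
    (hF : UniformlyContinuousWithModulus F ω) : HausdorffUniformContinuous F := by
  intro η hη
  have h_small : ∀ᶠ t in 𝓝[>] (0 : ℝ≥0), ω t < η.toNNReal :=
    hF.1.eventually (gt_mem_nhds (Real.toNNReal_pos.2 hη))
  obtain ⟨δ, hδ, hωδ⟩ := mem_nhdsGT_iff_exists_Ioc_subset.1 h_small
  refine ⟨δ, hδ, fun x x' hxx' => ?_⟩
  rcases eq_or_ne x x' with rfl | hne
  · exact self_subset_thickening hη _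
  · have hω : ω (nndist x x') < η.toNNReal :=
      hωδ ⟨pos_iff_ne_zero.2 (nndist_eq_zero.not.2 hne), hxx'⟩
    exact fun z hz => (infEDist_le_hausdorffEDist_of_mem hz).trans_lt
      ((hF.2 x x').trans_lt (ENNReal.coe_lt_coe.2 hω))

theorem dist_le_of_ediam_le {Y : Type*} [PseudoMetricSpace Y] {s : Set Y} {D : ℝ≥0}
    (hs : ediam s ≤ D) {a b : Y} (ha : a ∈ s) (hb : b ∈ s) : dist a b ≤ D :=
  edist_le_coe.1 ((edist_le_ediam_of_mem ha hb).trans hs)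

theorem lineMap_mem_thickening {E : Type*} [SeminormedAddCommGroup E] [NormedSpace ℝ E] {A : Set E}
    (hA : Convex ℝ A) {r t : ℝ} {y a : E} (hy : y ∈ thickening r A) (ha : a ∈ A)
    (ht : t ∈ Set.Ico (0 : ℝ) 1) : AffineMap.lineMap y a t ∈ thickening ((1 - t) * r) A := by
  obtain ⟨z, hz, hyz⟩ := mem_thickening_iff.1 hy
  refine mem_thickening_iff.2 ⟨_, hA.lineMap_mem hz ha ⟨ht.1, ht.2.le⟩, ?_⟩
  have ht_pos : 0 < 1 - t := sub_pos.2 ht.2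
  rw [AffineMap.lineMap_apply_module, AffineMap.lineMap_apply_module, dist_add_right, dist_smul₀,
    Real.norm_of_nonneg ht_pos.le]
  exact mul_lt_mul_of_pos_left hyz ht_pos

namespace HausdorffUniformContinuous

variable {X : Type*} [PseudoMetricSpace X]

theorem closure {Y : Type*} [PseudoMetricSpace Y] {F : X → Set Y}
    (hF : HausdorffUniformContinuous F) : HausdorffUniformContinuous fun x => closure (F x) := by
  intro η hη
  obtain ⟨δ, hδ, h⟩ := hF (η / 2) (half_pos hη)
  refine ⟨δ, hδ, fun x x' hxx' => ?_⟩
  calc _root_.closure (F x) ⊆ thickening (η / 2) (F x) :=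
        closure_subset_thickening (half_pos hη) _
    _ ⊆ thickening (η / 2) (thickening (η / 2) (F x')) :=
        thickening_subset_of_subset _ (h x x' hxx')
    _ ⊆ thickening (η / 2 + η / 2) (F x') := thickening_thickening_subset _ _ _
    _ = thickening η (_root_.closure (F x')) := by rw [add_halves, thickening_closure]

theorem preimage_add_left {E : Type*} [SeminormedAddCommGroup E] {F : X → Set E}
    (hF : HausdorffUniformContinuous F) {φ : X → E} (hφ : UniformContinuous φ) :
    HausdorffUniformContinuous fun x => (φ x + ·) ⁻¹' F x := by
  intro η hη
  obtain ⟨δ₁, hδ₁, h₁⟩ := hF (η / 2) (half_pos hη)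
  obtain ⟨δ₂, hδ₂, h₂⟩ := uniformContinuous_iff_le.1 hφ (η / 2) (half_pos hη)
  refine ⟨min δ₁ δ₂, lt_min hδ₁ hδ₂, fun x x' hxx' z hz => ?_⟩
  obtain ⟨w, hw, hzw⟩ := mem_thickening_iff.1 (h₁ x x' (hxx'.trans (min_le_left _ _)) hz)
  refine mem_thickening_iff.2 ⟨-φ x' + w, by simpa using hw, ?_⟩
  calc dist z (-φ x' + w) = dist (φ x' + z) w := by
        rw [← dist_add_left (φ x'), add_neg_cancel_left]
    _ ≤ dist (φ x' + z) (φ x + z) + dist (φ x + z) w := dist_triangle _ _ _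
    _ < η / 2 + η / 2 := by
        rw [dist_add_right, dist_comm]
        exact add_lt_add_of_le_of_lt (h₂ (hxx'.trans (min_le_right _ _))) hzw
    _ = η := add_halves η

theorem coe_preimage_thickening {E : Type*} [SeminormedAddCommGroup E] [NormedSpace ℝ E]
    {V : Submodule ℝ E} {F : X → Set E} (hF : HausdorffUniformContinuous F)
    (hF_convex : ∀ x, Convex ℝ (F x)) {D : ℝ≥0} (hD : ∀ x, ediam (F x) ≤ D)
    (hFV : ∀ x, ∃ a ∈ F x, a ∈ V) {ρ : ℝ} (hρ : 0 < ρ) :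
    HausdorffUniformContinuous fun x => ((↑) ⁻¹' thickening ρ (F x) : Set V) := by
  intro η hη
  set h : ℝ := η / (1 + D / ρ) with hh
  have hh_pos : 0 < h := by positivity
  obtain ⟨δ, hδ, hFδ⟩ := hF h hh_pos
  refine ⟨δ, hδ, fun x x' hxx' v hv => ?_⟩
  obtain ⟨a, ha, haV⟩ := hFV x'
  have hv_mem : (v : E) ∈ thickening (ρ + h) (F x') :=
    thickening_thickening_subset _ _ _ (thickening_subset_of_subset ρ (hFδ x x' hxx') hv)
  have hva : dist (v : E) a < ρ + h + D := by
    obtain ⟨z, hz, hvz⟩ := mem_thickening_iff.1 hv_mem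
    linarith [dist_triangle (v : E) z a, dist_le_of_ediam_le (hD x') hz ha]
  set t : ℝ := h / (ρ + h) with ht
  have ht_pos : 0 < t := by positivity
  have ht_lt : t < 1 := (div_lt_one (by positivity)).2 (by linarith)
  have h_radius : (1 - t) * (ρ + h) = ρ := by rw [ht]; field_simp; ring
  have h_mem := lineMap_mem_thickening (hF_convex x') hv_mem ha ⟨ht_pos.le, ht_lt⟩
  rw [h_radius] at h_mem
  refine mem_thickening_iff.2
    ⟨AffineMap.lineMap v ⟨a, haV⟩ t, by simpa [AffineMap.lineMap_apply_module] using h_mem, ?_⟩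
  calc dist v (AffineMap.lineMap v ⟨a, haV⟩ t) = t * dist (v : E) a := by
        rw [dist_left_lineMap, Real.norm_of_nonneg ht_pos.le, Subtype.dist_eq]
    _ < t * (ρ + h + D) := mul_lt_mul_of_pos_left hva ht_pos
    _ = h + h * (D / (ρ + h)) := by rw [ht]; field_simp
    _ ≤ h + h * (D / ρ) := by gcongr; linarith
    _ = η := by rw [hh]; field_simp

end HausdorffUniformContinuous

/-! ### Approximate selections -/

section Projection

variable {H : Type*} [NormedAddCommGroup H] [InnerProductSpace ℝ H]

theorem exists_mem_forall_inner_sub_le_zero {A : Set H} (hA_ne : A.Nonempty) (hA : IsComplete A)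
    (hA_convex : Convex ℝ A) (b : H) :
    ∃ p ∈ A, (∀ w ∈ A, ⟪b - p, w - p⟫ ≤ 0) ∧ ∀ w ∈ A, dist b p ≤ dist b w := by
  obtain ⟨p, hp, hp_min⟩ := exists_norm_eq_iInf_of_complete_convex hA_ne hA hA_convex b
  refine ⟨p, hp, (norm_eq_iInf_iff_real_inner_le_zero hA_convex hp).1 hp_min, fun w hw => ?_⟩
  rw [dist_eq_norm, hp_min, dist_eq_norm]
  exact ciInf_le ⟨0, Set.forall_mem_range.2 fun w : A => norm_nonneg (b - w)⟩ ⟨w, hw⟩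

theorem inner_sub_le_of_mem_thickening {A : Set H} {b p q : H} {R h : ℝ}
    (hp : ∀ w ∈ A, ⟪b - p, w - p⟫ ≤ 0) (hbp : dist b p ≤ R) (hq : q ∈ thickening h A) :
    ⟪b - p, q - p⟫ ≤ R * h := by
  obtain ⟨w, hw, hqw⟩ := mem_thickening_iff.1 hq
  rw [dist_eq_norm] at hbp hqw
  calc ⟪b - p, q - p⟫ = ⟪b - p, w - p⟫ + ⟪b - p, q - w⟫ := by rw [← inner_add_right]; congr 1; abel
    _ ≤ 0 + ‖b - p‖ * ‖q - w‖ := add_le_add (hp w hw) (real_inner_le_norm _ _)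
    _ ≤ R * h := by
        rw [zero_add]
        exact mul_le_mul hbp hqw.le (norm_nonneg _) ((norm_nonneg _).trans hbp)

theorem dist_sq_le_of_forall_inner_sub_le_zero {A A' : Set H} {b b' p p' : H} {R h : ℝ}
    (hpA : p ∈ A) (hp : ∀ w ∈ A, ⟪b - p, w - p⟫ ≤ 0) (hbp : dist b p ≤ R)
    (hpA' : p' ∈ A') (hp' : ∀ w ∈ A', ⟪b' - p', w - p'⟫ ≤ 0) (hbp' : dist b' p' ≤ R)
    (hAA' : A ⊆ thickening h A') (hA'A : A' ⊆ thickening h A) :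
    dist p p' ^ 2 ≤ 2 * (R * h) + dist b b' * dist p p' := by
  have h_inner := inner_sub_le_of_mem_thickening hp hbp (hA'A hpA')
  have h_inner' := inner_sub_le_of_mem_thickening hp' hbp' (hAA' hpA)
  have h_cs : ⟪b - b', p - p'⟫ ≤ dist b b' * dist p p' := by
    rw [dist_eq_norm, dist_eq_norm]
    exact real_inner_le_norm _ _
  have h_sum : dist p p' ^ 2 = ⟪b - p, p' - p⟫ + ⟪b' - p', p - p'⟫ + ⟪b - b', p - p'⟫ := by
    rw [dist_eq_norm, ← real_inner_self_eq_norm_sq]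
    simp only [inner_sub_left, inner_sub_right, real_inner_comm]
    ring
  linarith

theorem HausdorffUniformContinuous.uniformContinuous_of_forall_inner_sub_le_zero {X : Type*}
    [PseudoMetricSpace X] {F : X → Set H} (hF : HausdorffUniformContinuous F) {b p : X → H}
    (hb : UniformContinuous b) {R : ℝ} (hR : 0 ≤ R) (hpF : ∀ x, p x ∈ F x)
    (hp : ∀ x, ∀ w ∈ F x, ⟪b x - p x, w - p x⟫ ≤ 0) (hbp : ∀ x, dist (b x) (p x) ≤ R) :
    UniformContinuous p := by
  refine uniformContinuous_iff_le.2 fun η hη => ?_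
  set h : ℝ := η ^ 2 / (4 * (R + 1)) with hh
  have hRh : 2 * (R * h) ≤ η ^ 2 / 2 := by
    have h_scaled : (R + 1) * h = η ^ 2 / 4 := by rw [hh]; field_simp
    have hh_pos : 0 < h := by positivity
    linarith
  obtain ⟨δ₁, hδ₁, hFδ⟩ := hF h (by positivity)
  obtain ⟨δ₂, hδ₂, hbδ⟩ := uniformContinuous_iff_le.1 hb (η / 2) (half_pos hη)
  refine ⟨min δ₁ δ₂, lt_min hδ₁ hδ₂, fun x x' hxx' => ?_⟩
  have h₁ : dist x x' ≤ δ₁ := hxx'.trans (min_le_left _ _)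
  have h_sq := dist_sq_le_of_forall_inner_sub_le_zero (hpF x) (hp x) (hbp x) (hpF x') (hp x')
    (hbp x') (hFδ x x' h₁) (hFδ x' x (dist_comm x x' ▸ h₁))
  have h_base := mul_le_mul_of_nonneg_right (hbδ (hxx'.trans (min_le_right _ _)))
    (dist_nonneg (x := p x) (y := p x'))
  by_contra! h_lt
  nlinarith

end Projection

section Selection

variable {X : Type*} [NormedAddCommGroup X] [InnerProductSpace ℝ X] {X₁ : Set X}
  {H : Type*} [NormedAddCommGroup H] [InnerProductSpace ℝ H] [CompleteSpace H]

theorem HausdorffUniformContinuous.exists_lipschitzWith_forall_exists_mem_dist_le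
    (hX₁ : Convex ℝ X₁) {F : X₁ → Set H} (hF : HausdorffUniformContinuous F)
    (hF_ne : ∀ x, (F x).Nonempty) {D : ℝ≥0} (hD : ∀ x, ediam (F x) ≤ D) :
    ∃ b : X₁ → H, (∃ K : ℝ≥0, LipschitzWith K b) ∧
      ∃ R ≥ 0, ∀ x, ∃ z ∈ F x, dist (b x) z ≤ R := by
  choose s hs using hF_ne
  obtain ⟨δ, hδ, hFδ⟩ := hF 1 one_pos
  have hs_dist : ∀ x x', dist x x' ≤ δ → dist (s x) (s x') ≤ 1 + D := by
    intro x x' hxx'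
    obtain ⟨z, hz, hsz⟩ := mem_thickening_iff.1 (hFδ x x' hxx' (hs x))
    exact (dist_triangle _ z _).trans (add_le_add hsz.le (dist_le_of_ediam_le (hD x') hz (hs x')))
  obtain ⟨b, hb, hbs⟩ := exists_lipschitzWith_forall_dist_le hX₁ hδ (by positivity) hs_dist
  exact ⟨b, hb, 3 * (1 + D), by positivity, fun x => ⟨s x, hs x, hbs x⟩⟩

theorem HausdorffUniformContinuous.exists_uniformContinuous_forall_mem (hX₁ : Convex ℝ X₁)
    {F : X₁ → Set H} (hF : HausdorffUniformContinuous F) (hF_ne : ∀ x, (F x).Nonempty)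
    (hF_convex : ∀ x, Convex ℝ (F x)) (hF_closed : ∀ x, IsClosed (F x)) {D : ℝ≥0}
    (hD : ∀ x, ediam (F x) ≤ D) : ∃ p : X₁ → H, UniformContinuous p ∧ ∀ x, p x ∈ F x := by
  obtain ⟨b, ⟨K, hb⟩, R, hR, hbR⟩ :=
    hF.exists_lipschitzWith_forall_exists_mem_dist_le hX₁ hF_ne hD
  choose p hpF hp hp_min using fun x =>
    exists_mem_forall_inner_sub_le_zero (hF_ne x) (hF_closed x).isComplete (hF_convex x) (b x)
  refine ⟨p, hF.uniformContinuous_of_forall_inner_sub_le_zero hb.uniformContinuous hR hpF hp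
    fun x => ?_, hpF⟩
  obtain ⟨z, hz, hbz⟩ := hbR x
  exact (hp_min x z hz).trans hbz

theorem HausdorffUniformContinuous.exists_lipschitzWith_forall_mem_thickening (hX₁ : Convex ℝ X₁)
    {F : X₁ → Set H} (hF : HausdorffUniformContinuous F) (hF_ne : ∀ x, (F x).Nonempty)
    (hF_convex : ∀ x, Convex ℝ (F x)) {D : ℝ≥0} (hD : ∀ x, ediam (F x) ≤ D) {ε : ℝ} (hε : 0 < ε) :
    ∃ g : X₁ → H, (∃ K : ℝ≥0, LipschitzWith K g) ∧ ∀ x, g x ∈ thickening ε (F x) := by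
  obtain ⟨p, hp, hpF⟩ := hF.closure.exists_uniformContinuous_forall_mem hX₁
    (fun x => (hF_ne x).closure) (fun x => (hF_convex x).closure) (fun x => isClosed_closure)
    (fun x => (ediam_closure (F x)).trans_le (hD x))
  obtain ⟨δ, hδ, hpδ⟩ := uniformContinuous_iff_le.1 hp (ε / 6) (by positivity)
  obtain ⟨g, hg, hgp⟩ := exists_lipschitzWith_forall_dist_le hX₁ hδ (by positivity)
    fun x x' => @hpδ x x'
  refine ⟨g, hg, fun x => ?_⟩
  rw [← thickening_closure]
  exact mem_thickening_iff.2 ⟨p x, hpF x, (hgp x).trans_lt (by linarith)⟩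

theorem HausdorffUniformContinuous.exists_lipschitzWith_forall_mem_submodule_inter_thickening
    (hX₁ : Convex ℝ X₁) {V : Submodule ℝ H} (hV : IsClosed (V : Set H)) {F : X₁ → Set H}
    (hF : HausdorffUniformContinuous F) (hF_convex : ∀ x, Convex ℝ (F x)) {D : ℝ≥0}
    (hD : ∀ x, ediam (F x) ≤ D) (hFV : ∀ x, ∃ a ∈ F x, a ∈ V) {ε : ℝ} (hε : 0 < ε) :
    ∃ v : X₁ → H, (∃ K : ℝ≥0, LipschitzWith K v) ∧ ∀ x, v x ∈ V ∧ v x ∈ thickening ε (F x) := by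
  have : CompleteSpace V := hV.completeSpace_coe
  obtain ⟨ρ, hρ⟩ : ∃ ρ : ℝ≥0, (ρ : ℝ) = ε / 2 := ⟨⟨ε / 2, by positivity⟩, rfl⟩
  have hρ_pos : (0 : ℝ) < ρ := hρ ▸ half_pos hε
  let G : X₁ → Set V := fun x => (↑) ⁻¹' thickening ρ (F x)
  have hG_ne : ∀ x, (G x).Nonempty := fun x =>
    let ⟨a, ha, haV⟩ := hFV x
    ⟨⟨a, haV⟩, self_subset_thickening hρ_pos _ ha⟩
  have hG_convex : ∀ x, Convex ℝ (G x) := fun x =>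
    ((hF_convex x).thickening ρ).linear_preimage V.subtype
  have hG_ediam : ∀ x, ediam (G x) ≤ (D + 2 * ρ : ℝ≥0) := fun x =>
    calc ediam (G x) ≤ ediam (thickening ρ (F x)) := by
          simpa using V.subtypeₗᵢ.isometry.antilipschitz.ediam_preimage_le (thickening ρ (F x))
      _ ≤ D + 2 * ρ := (ediam_thickening_le ρ).trans (by gcongr; exact hD x)
      _ = (D + 2 * ρ : ℝ≥0) := by push_cast; rfl
  obtain ⟨v, ⟨K, hv⟩, hvG⟩ :=
    (hF.coe_preimage_thickening hF_convex hD hFV hρ_pos).exists_lipschitzWith_forall_mem_thickening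
      hX₁ hG_ne hG_convex hG_ediam (half_pos hε)
  refine ⟨fun x => v x, ⟨K, hv⟩, fun x => ⟨(v x).2, ?_⟩⟩
  obtain ⟨w, hw, hvw⟩ := mem_thickening_iff.1 (hvG x)
  have hv_mem : (v x : H) ∈ thickening (ε / 2) (thickening ρ (F x)) :=
    mem_thickening_iff.2 ⟨w, hw, hvw⟩
  simpa [hρ] using thickening_thickening_subset _ _ _ hv_mem

theorem hasRightInverse_of_closedComplemented_ker {𝕜 E F : Type*} [NontriviallyNormedField 𝕜]
    [NormedAddCommGroup E] [NormedSpace 𝕜 E] [CompleteSpace E] [NormedAddCommGroup F]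
    [NormedSpace 𝕜 F] [CompleteSpace F] {L : E →L[𝕜] F} (hL : Function.Surjective L)
    (h_ker : L.ker.ClosedComplemented) : L.HasRightInverse := by
  obtain ⟨P, hP⟩ := h_ker
  have : CompleteSpace L.ker := L.isClosed_ker.completeSpace_coe
  let e : E ≃L[𝕜] F × L.ker := L.equivProdOfSurjectiveOfIsCompl P (LinearMap.range_eq_top.2 hL)
    (LinearMap.range_eq_of_proj hP) (LinearMap.isCompl_of_proj hP)
  refine ⟨e.symm.toContinuousLinearMap.comp (.inl 𝕜 F L.ker), fun y => ?_⟩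
  exact congrArg Prod.fst (e.apply_symm_apply (y, 0))

theorem HausdorffUniformContinuous.exists_lipschitzWith_lift_mem_thickening (hX₁ : Convex ℝ X₁)
    {Y : Type*} [NormedAddCommGroup Y] [NormedSpace ℝ Y] [CompleteSpace Y] {L : H →L[ℝ] Y}
    (hL : Function.Surjective L) {F : X₁ → Set H} (hF : HausdorffUniformContinuous F)
    (hF_convex : ∀ x, Convex ℝ (F x)) {D : ℝ≥0} (hD : ∀ x, ediam (F x) ≤ D)
    {f : X₁ → Y} {K : ℝ≥0} (hf : LipschitzWith K f) (hfF : ∀ x, f x ∈ L '' F x)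
    {ε : ℝ} (hε : 0 < ε) :
    ∃ g : X₁ → H, (∃ C : ℝ≥0, LipschitzWith C g) ∧ (∀ x, L (g x) = f x) ∧
      ∀ x, g x ∈ thickening ε (F x) := by
  have : CompleteSpace L.ker := L.isClosed_ker.completeSpace_coe
  obtain ⟨R, hR⟩ := hasRightInverse_of_closedComplemented_ker hL
    ⟨L.ker.orthogonalProjectionOnto, L.ker.orthogonalProjectionOnto_mem_subspace_eq_self⟩
  have hRf : LipschitzWith (‖R‖₊ * K) fun x => R (f x) := R.lipschitz.comp hf
  obtain ⟨v, ⟨C, hv⟩, hvF⟩ := (hF.preimage_add_left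
    hRf.uniformContinuous).exists_lipschitzWith_forall_mem_submodule_inter_thickening hX₁
      L.isClosed_ker (fun x => (hF_convex x).translate_preimage_right (R (f x)))
      (fun x => ((IsometryEquiv.addLeft (R (f x))).ediam_preimage (F x)).trans_le (hD x))
      (fun x => by
        obtain ⟨a, ha, hLa⟩ := hfF x
        exact ⟨a - R (f x), by simpa using ha, by simp [hLa, hR (f x)]⟩) hε
  refine ⟨fun x => R (f x) + v x, ⟨_, hRf.add hv⟩, fun x => ?_, fun x => ?_⟩
  · have hLv : L (v x) = 0 := (hvF x).1
    rw [map_add, hR (f x), hLv, add_zero]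
  · obtain ⟨z, hz, hvz⟩ := mem_thickening_iff.1 (hvF x).2
    exact mem_thickening_iff.2 ⟨R (f x) + z, hz, by rwa [dist_add_left]⟩

end Selection

/-! ### Pairs of set-valued maps -/

section PairSet

theorem convex_pairSet {E₁ E₂ : Type*} [AddCommGroup E₁] [Module ℝ E₁] [AddCommGroup E₂]
    [Module ℝ E₂] {A : Set E₁} {B : Set E₂} (hA : Convex ℝ A) (hB : Convex ℝ B) :
    Convex ℝ (pairSet A B) := fun _ hz _ hw _ _ ha hb hab =>
  ⟨hA hz.1 hw.1 ha hb hab, hB hz.2 hw.2 ha hb hab⟩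

variable {E₁ E₂ : Type*} [SeminormedAddCommGroup E₁] [SeminormedAddCommGroup E₂]

theorem thickening_pairSet_subset (A : Set E₁) (B : Set E₂) (ε : ℝ) :
    thickening ε (pairSet A B) ⊆ pairSet (thickening ε A) (thickening ε B) := by
  intro z hz
  obtain ⟨w, hw, hzw⟩ := mem_thickening_iff.1 hz
  exact ⟨mem_thickening_iff.2 ⟨w.fst, hw.1, (WithLp.dist_fst_le z w).trans_lt hzw⟩,
    mem_thickening_iff.2 ⟨w.snd, hw.2, (WithLp.dist_snd_le z w).trans_lt hzw⟩⟩

theorem pairSet_thickening_subset (A : Set E₁) (B : Set E₂) (ε₁ ε₂ : ℝ) :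
    pairSet (thickening ε₁ A) (thickening ε₂ B) ⊆ thickening (ε₁ + ε₂) (pairSet A B) := by
  rintro z ⟨hzA, hzB⟩
  obtain ⟨a, ha, hza⟩ := mem_thickening_iff.1 hzA
  obtain ⟨b, hb, hzb⟩ := mem_thickening_iff.1 hzB
  refine mem_thickening_iff.2 ⟨WithLp.toLp 2 (a, b), ⟨ha, hb⟩, ?_⟩
  have h_cross : 0 ≤ 2 * dist z.fst a * dist z.snd b := by positivity
  calc dist z (WithLp.toLp 2 (a, b)) = √(dist z.fst a ^ 2 + dist z.snd b ^ 2) :=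
        WithLp.prod_dist_eq_of_L2 _ _
    _ ≤ dist z.fst a + dist z.snd b := Real.sqrt_le_iff.2
        ⟨add_nonneg dist_nonneg dist_nonneg, by rw [add_sq']; linarith⟩
    _ < ε₁ + ε₂ := add_lt_add hza hzb

theorem HausdorffUniformContinuous.pairSet {X : Type*} [PseudoMetricSpace X] {F₁ : X → Set E₁}
    {F₂ : X → Set E₂} (hF₁ : HausdorffUniformContinuous F₁)
    (hF₂ : HausdorffUniformContinuous F₂) :
    HausdorffUniformContinuous fun x => pairSet (F₁ x) (F₂ x) := by
  intro η hη
  obtain ⟨δ₁, hδ₁, h₁⟩ := hF₁ (η / 2) (half_pos hη)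
  obtain ⟨δ₂, hδ₂, h₂⟩ := hF₂ (η / 2) (half_pos hη)
  refine ⟨min δ₁ δ₂, lt_min hδ₁ hδ₂, fun x x' hxx' z hz => ?_⟩
  simpa only [add_halves] using pairSet_thickening_subset _ _ _ _
    ⟨h₁ x x' (hxx'.trans (min_le_left _ _)) hz.1, h₂ x x' (hxx'.trans (min_le_right _ _)) hz.2⟩

end PairSet

theorem thickening_subset_add_closedBall {E : Type*} [SeminormedAddCommGroup E] (ε : ℝ)
    (A : Set E) : thickening ε A ⊆ A + closedBall 0 ε := by
  rw [← add_ball_zero]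
  exact Set.add_subset_add_left ball_subset_closedBall

theorem theorem3_general
    {X Y Y₁ Y₂ : Type*}
    [NormedAddCommGroup X] [InnerProductSpace ℝ X]
    [NormedAddCommGroup Y] [NormedSpace ℝ Y] [CompleteSpace Y]
    [NormedAddCommGroup Y₁] [InnerProductSpace ℝ Y₁] [CompleteSpace Y₁]
    [NormedAddCommGroup Y₂] [InnerProductSpace ℝ Y₂] [CompleteSpace Y₂]
    (X₁ : Set X) (hX₁ : Convex ℝ X₁)
    (L : WithLp 2 (Y₁ × Y₂) →L[ℝ] Y) (hL : Function.Surjective L)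
    (F₁ : X₁ → Set Y₁) (F₂ : X₁ → Set Y₂) (ω₁ ω₂ : ℝ≥0 → ℝ≥0)
    (hF₁ : UniformlyContinuousWithModulus F₁ ω₁)
    (hF₂ : UniformlyContinuousWithModulus F₂ ω₂)
    (hF₁_convex : ∀ x, Convex ℝ (F₁ x)) (hF₂_convex : ∀ x, Convex ℝ (F₂ x))
    (hd : (⨆ x : X₁, Metric.ediam (pairSet (F₁ x) (F₂ x))) < ⊤)
    (f : X₁ → Y) (hf : ∃ K : ℝ≥0, LipschitzWith K f)
    (hf_sel : ∀ x, f x ∈ L '' pairSet (F₁ x) (F₂ x))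
    (ε : ℝ) (hε : 0 < ε) :
    ∃ (f₁ : X₁ → Y₁) (f₂ : X₁ → Y₂),
      (∃ K₁ : ℝ≥0, LipschitzWith K₁ f₁) ∧
      (∃ K₂ : ℝ≥0, LipschitzWith K₂ f₂) ∧
      (∀ x, f₁ x ∈ F₁ x + Metric.closedBall 0 ε) ∧
      (∀ x, f₂ x ∈ F₂ x + Metric.closedBall 0 ε) ∧
      (∀ x, f x = L (WithLp.toLp 2 (f₁ x, f₂ x))) := by
  obtain ⟨K, hf⟩ := hf
  obtain ⟨D, hD⟩ := WithTop.ne_top_iff_exists.1 hd.ne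
  have h_ediam : ∀ x, ediam (pairSet (F₁ x) (F₂ x)) ≤ D := fun x =>
    (le_iSup (fun x => ediam (pairSet (F₁ x) (F₂ x))) x).trans_eq hD.symm
  obtain ⟨g, ⟨C, hg⟩, hLg, hgF⟩ := (hF₁.hausdorffUniformContinuous.pairSet
    hF₂.hausdorffUniformContinuous).exists_lipschitzWith_lift_mem_thickening hX₁ hL
      (fun x => convex_pairSet (hF₁_convex x) (hF₂_convex x)) h_ediam hf hf_sel hε
  have hg_pair := fun x => thickening_pairSet_subset _ _ _ (hgF x)
  exact ⟨fun x => (g x).fst, fun x => (g x).snd,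
    ⟨C, fun x x' => (WithLp.edist_fst_le _ _).trans (hg x x')⟩,
    ⟨C, fun x x' => (WithLp.edist_snd_le _ _).trans (hg x x')⟩,
    fun x => thickening_subset_add_closedBall ε _ (hg_pair x).1,
    fun x => thickening_subset_add_closedBall ε _ (hg_pair x).2,
    fun x => (hLg x).symm⟩

theorem theorem3
    {X Y Y₁ Y₂ : Type*}
    [NormedAddCommGroup X] [InnerProductSpace ℝ X] [CompleteSpace X]
    [NormedAddCommGroup Y] [InnerProductSpace ℝ Y] [CompleteSpace Y]
    [NormedAddCommGroup Y₁] [InnerProductSpace ℝ Y₁] [CompleteSpace Y₁]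
    [NormedAddCommGroup Y₂] [InnerProductSpace ℝ Y₂] [CompleteSpace Y₂]
    (X₁ : Set X) (hX₁ : Convex ℝ X₁)
    (L : WithLp 2 (Y₁ × Y₂) →L[ℝ] Y) (hL : Function.Surjective L)
    (F₁ : X₁ → Set Y₁) (F₂ : X₁ → Set Y₂) (ω₁ ω₂ : ℝ≥0 → ℝ≥0)
    (hF₁ : UniformlyContinuousWithModulus F₁ ω₁)
    (hF₂ : UniformlyContinuousWithModulus F₂ ω₂)
    (hF₁_img : ∀ x, Convex ℝ (F₁ x) ∧ IsClosed (F₁ x) ∧ Bornology.IsBounded (F₁ x))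
    (hF₂_img : ∀ x, Convex ℝ (F₂ x) ∧ IsClosed (F₂ x) ∧ Bornology.IsBounded (F₂ x))
    (hd : (⨆ x : X₁, Metric.ediam (pairSet (F₁ x) (F₂ x))) < ⊤)
    (f : X₁ → Y) (hf : ∃ K : ℝ≥0, LipschitzWith K f)
    (hf_sel : ∀ x, f x ∈ L '' pairSet (F₁ x) (F₂ x))
    (ε : ℝ) (hε : 0 < ε) :
    ∃ (f₁ : X₁ → Y₁) (f₂ : X₁ → Y₂),
      (∃ K₁ : ℝ≥0, LipschitzWith K₁ f₁) ∧
      (∃ K₂ : ℝ≥0, LipschitzWith K₂ f₂) ∧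
      (∀ x, f₁ x ∈ F₁ x + Metric.closedBall 0 ε) ∧
      (∀ x, f₂ x ∈ F₂ x + Metric.closedBall 0 ε) ∧
      (∀ x, f x = L (WithLp.toLp 2 (f₁ x, f₂ x))) :=
  theorem3_general X₁ hX₁ L hL F₁ F₂ ω₁ ω₂ hF₁ hF₂ (fun x => (hF₁_img x).1)
    (fun x => (hF₂_img x).1) hd f hf hf_sel ε hε
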